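/- **Definitions.** A lattice simplex of dimension $d$ in $\mathbb{R}^d$ is the convex hull $\Delta$ of $d+1$ affinely independent points $v_0,\dots,v_d\in\mathbb{Z}^d$. Its $\delta$-polynomial is $$\delta(\Delta,t)=(1-t)^{d+1}\Bigl(1+\sum_{n\ge 1}|n\Delta\cap\mathbb{Z}^d|\,t^n\Bigr),$$ and $$\Lambda_\Delta=\Bigl\{(\lambda_0,\dots,\lambda_d)\in(\mathbb{R}/\mathbb{Z})^{d+1}:\ \sum_{i=0}^d\lambda_i\,(v_i,1)\in\mathbb{Z}^{d+1}\Bigr\}.$$ For $d\ge 1$, $\Delta$ is called a lattice pyramid if there is a lattice simplex $\Delta'\subset\mathbb{R}^{d-1}$ of dimension $d-1$ such that $\Delta$ is unimodularly equivalent to $\operatorname{conv}(\Delta'\times\{0\},(0,\dots,0,1))\subset\mathbb{R}^d$, that is, equal to it up to a map $x\mapsto xU+w$ with $U\in\mathbb{Z}^{d\times d}$, $\det U=\pm1$, $w\in\mathbb{Z}^d$. **Theorem.** Let $v>0$ and $k\ge 0$ be integers. Then there exist $d\ge 0$ and a lattice simplex $\Delta\subset\mathbb{R}^d$ of dimension $d$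 with $$\delta(\Delta,t)=1+t^{k+1}+t^{2(k+1)}+\cdots+t^{(v-1)(k+1)}.\qquad(*)$$ Furthermore, let $d\ge 1$ and let $\Delta\subset\mathbb{R}^d$ be any lattice simplex of dimension $d$ that satisfies $(*)$ and is not a lattice pyramid. Then $$v(k+1)-1\ \le\ d\ \le\ 4(v-1)(k+1)-2,$$ and $d=v(k+1)-1$ holds if and only if $\Lambda_\Delta$ is generated by the single element $(1/v,\dots,1/v)\in(\mathbb{R}/\mathbb{Z})^{d+1}$. -/

import Mathlib

open scoped Pointwise

/-- The full-dimensional simplex `s` in `ℝ^d` is a lattice simplex: its vertices `v₀, …, v_d`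
have integer coordinates. (Affine independence of the vertices is part of `Affine.Simplex`.) -/
def IsLatticeSimplex {d : ℕ} (s : Affine.Simplex ℝ (Fin d → ℝ) d) : Prop :=
  ∀ i j, ∃ z : ℤ, s.points i j = (z : ℝ)

/-- The convex polytope spanned by the vertices of a simplex. -/
def simplexHull {d : ℕ} (s : Affine.Simplex ℝ (Fin d → ℝ) d) : Set (Fin d → ℝ) :=
  convexHull ℝ (Set.range s.points)

/-- The number `|nP ∩ ℤ^d|` of lattice points in the `n`-th dilate of `P`. -/
noncomputable def latticePointCount {d : ℕ} (P : Set (Fin d → ℝ)) (n : ℕ) : ℕ :=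
  Set.ncard {z : Fin d → ℤ | (fun j => (z j : ℝ)) ∈ (n : ℝ) • P}

/-- The Ehrhart series `1 + ∑_{n ≥ 1} |nP ∩ ℤ^d| t^n`. -/
noncomputable def ehrhartSeries {d : ℕ} (P : Set (Fin d → ℝ)) : PowerSeries ℤ :=
  PowerSeries.mk fun n => if n = 0 then 1 else (latticePointCount P n : ℤ)

/-- The `δ`-polynomial `δ(P, t) = (1 - t)^{d+1} (1 + ∑_{n ≥ 1} |nP ∩ ℤ^d| t^n)` of a
`d`-dimensional lattice polytope `P` in `ℝ^d`, as a formal power series. -/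
noncomputable def deltaSeries {d : ℕ} (P : Set (Fin d → ℝ)) : PowerSeries ℤ :=
  (1 - PowerSeries.X) ^ (d + 1) * ehrhartSeries P

/-- The group `Λ_Δ` of all `(λ₀, …, λ_d) ∈ (ℝ/ℤ)^{d+1}` with `∑ λᵢ (vᵢ, 1) ∈ ℤ^{d+1}`. For integral
`vᵢ` the condition does not depend on the real representatives `rᵢ` of the `λᵢ`. -/
def simplexGroup {d : ℕ} (s : Affine.Simplex ℝ (Fin d → ℝ) d) :
    AddSubgroup (Fin (d + 1) → UnitAddCircle) where
  carrier := {l | ∃ r : Fin (d + 1) → ℝ, (∀ i, (r i : UnitAddCircle) = l i) ∧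
    (∀ j, ∃ z : ℤ, ∑ i, r i * s.points i j = (z : ℝ)) ∧ ∃ z : ℤ, ∑ i, r i = (z : ℝ)}
  zero_mem' := ⟨0, by simp, fun j => ⟨0, by simp⟩, 0, by simp⟩
  add_mem' := by
    rintro a b ⟨r, hr, h1, z, hz⟩ ⟨r', hr', h1', z', hz'⟩
    refine ⟨r + r', fun i => by simp [← hr, ← hr'], fun j => ?_, z + z', ?_⟩
    · obtain ⟨x, hx⟩ := h1 j
      obtain ⟨y, hy⟩ := h1' j
      exact ⟨x + y, by simp [add_mul, Finset.sum_add_distrib, hx, hy]⟩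
    · simp [Finset.sum_add_distrib, hz, hz']
  neg_mem' := by
    rintro a ⟨r, hr, h1, z, hz⟩
    refine ⟨-r, fun i => by simp [← hr], fun j => ?_, -z, ?_⟩
    · obtain ⟨x, hx⟩ := h1 j
      exact ⟨-x, by simp [hx]⟩
    · simp [hz]

/-- Unimodular equivalence in `ℝ^d`: `Q = P U + w` with `U` an integer matrix of determinant
`±1` and `w` an integer vector. -/
def UnimodularlyEquivalent {d : ℕ} (P Q : Set (Fin d → ℝ)) : Prop :=
  ∃ (U : Matrix (Fin d) (Fin d) ℤ) (w : Fin d → ℤ), (U.det = 1 ∨ U.det = -1) ∧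
    Q = (fun x => Matrix.vecMul x (U.map (fun a => (a : ℝ))) + fun j => (w j : ℝ)) '' P

/-- The lattice pyramid `Pyr(P) = conv(P × {0}, (0, …, 0, 1))` in `ℝ^{d+1}`. -/
def latticePyramid {d : ℕ} (P : Set (Fin d → ℝ)) : Set (Fin (d + 1) → ℝ) :=
  convexHull ℝ ((fun x => Fin.snoc (α := fun _ => ℝ) x 0) '' P ∪
    {Fin.snoc (α := fun _ => ℝ) 0 1})

/-- A subset of `ℝ^d` is a lattice pyramid over a lower-dimensional lattice simplex: up to
unimodular equivalence, it is `Pyr(Δ')` for a lattice simplex `Δ'` of dimension `d - 1`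
(an iterated pyramid is also of this form). A point, in `ℝ^0`, is not such a pyramid. -/
def IsLatticePyramid : {d : ℕ} → Set (Fin d → ℝ) → Prop
  | 0, _ => False
  | e + 1, Q => ∃ s : Affine.Simplex ℝ (Fin e → ℝ) e, IsLatticeSimplex s ∧
      UnimodularlyEquivalent Q (latticePyramid (simplexHull s))

/-! Write Λ for the group of the simplex, and let the height of λ ∈ Λ be the sum of its
representatives in [0, 1). Splitting the scaled barycentric coordinates of the lattice points in nΔ
into fractional and integral parts shows that δ(Δ, t) = ∑ t^{height λ} over Λ
(`deltaSeries_simplexHull`). So (*) gives |Λ| = v on evaluating at t = 1, and, on differentiating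
there, twice the sum of the heights is v(v-1)(k+1).

The heights of λ and -λ add up to the number of nonzero coordinates of λ. With Λ_i the subgroup
where coordinate i vanishes, this gives v(v-1)(k+1) = ∑_i (v - |Λ_i|) (`two_mul_sum_height`). If Δ
is not a pyramid, no Λ_i is all of Λ (`isLatticePyramid_of_coord_eq_zero`), so 1 ≤ |Λ_i| ≤ v/2 by
Lagrange. Hence (d+1)v/2 ≤ v(v-1)(k+1) ≤ (d+1)(v-1), which yields both bounds, the upper one even as
d + 1 ≤ 2(v-1)(k+1).

Equality on the left means that every Λ_i is trivial. An element of height k+1 = (d+1)/v then has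
all coordinates at least 1/v, hence equal to 1/v, and it generates Λ (`simplexGroup_eq_zmultiples`).
Existence comes from an explicit simplex whose group is generated by (1/v, …, 1/v). -/

/-! ### Representatives of ℝ/ℤ in [0, 1) -/

/-- The representative in `[0, 1)` of an element of `ℝ/ℤ`. -/
noncomputable def circleFract (x : UnitAddCircle) : ℝ := (AddCircle.equivIco 1 0 x : ℝ)

lemma circleFract_nonneg (x : UnitAddCircle) : 0 ≤ circleFract x :=
  (AddCircle.equivIco 1 0 x).2.1

lemma circleFract_lt_one (x : UnitAddCircle) : circleFract x < 1 := by
  simpa [circleFract] using (AddCircle.equivIco 1 0 x).2.2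

lemma coe_circleFract (x : UnitAddCircle) : (circleFract x : UnitAddCircle) = x :=
  AddCircle.coe_equivIco

lemma circleFract_coe (r : ℝ) : circleFract (r : UnitAddCircle) = Int.fract r :=
  (AddCircle.coe_equivIco_mk_apply (p := (1 : ℝ)) r).trans (by simp)

lemma circleFract_injective : Function.Injective circleFract := fun x y h => by
  rw [← coe_circleFract x, h, coe_circleFract]

@[simp] lemma circleFract_zero : circleFract 0 = 0 := by
  simpa using circleFract_coe 0

lemma circleFract_eq_zero_iff {x : UnitAddCircle} : circleFract x = 0 ↔ x = 0 :=
  ⟨fun h => circleFract_injective (by simpa using h), fun h => by simp [h]⟩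

lemma circleFract_add_neg (x : UnitAddCircle) :
    circleFract x + circleFract (-x) = if x = 0 then 0 else 1 := by
  split_ifs with h
  · simp [h]
  · have h0 : Int.fract (circleFract x) ≠ 0 := by
      rwa [Int.fract_eq_self.2 ⟨circleFract_nonneg x, circleFract_lt_one x⟩, Ne,
        circleFract_eq_zero_iff]
    have h1 : circleFract (-x) = 1 - circleFract x := by
      conv_lhs => rw [← coe_circleFract x, ← AddCircle.coe_neg, circleFract_coe, Int.fract_neg h0,
        Int.fract_eq_self.2 ⟨circleFract_nonneg x, circleFract_lt_one x⟩]
    rw [h1]; ring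

lemma coe_unitAddCircle_eq_iff {r t : ℝ} :
    (r : UnitAddCircle) = t ↔ ∃ z : ℤ, r - t = z := by
  rw [← sub_eq_zero, ← AddCircle.coe_sub, AddCircle.coe_eq_zero_iff]
  simp [eq_comm]

/-! ### The group of a lattice simplex: membership, height, finiteness -/

section

variable {d : ℕ} {s : Affine.Simplex ℝ (Fin d → ℝ) d}

lemma Affine.Simplex.coeff_eq_zero {c : Fin (d + 1) → ℝ} (h : ∑ i, c i = 0)
    (h' : ∀ j, ∑ i, c i * s.points i j = 0) : c = 0 := by
  ext i
  refine affineIndependent_iff.1 s.independent Finset.univ c h ?_ i (Finset.mem_univ _)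
  ext j
  simpa using h' j

lemma Affine.Simplex.coeff_injective {c c' : Fin (d + 1) → ℝ} (h : ∑ i, c i = ∑ i, c' i)
    (h' : ∀ j, ∑ i, c i * s.points i j = ∑ i, c' i * s.points i j) : c = c' := by
  refine sub_eq_zero.1 (s.coeff_eq_zero (c := c - c') ?_ fun j => ?_)
  · simp [h]
  · simp [sub_mul, h' j]

/-- Two choices of real representatives differ by integers, and the vertices are integral, so the
sums change by integers only. -/
lemma coe_mem_simplexGroup_iff (hs : IsLatticeSimplex s) (c : Fin (d + 1) → ℝ) :
    (fun i => (c i : UnitAddCircle)) ∈ simplexGroup s ↔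
      (∀ j, ∃ z : ℤ, ∑ i, c i * s.points i j = z) ∧ ∃ z : ℤ, ∑ i, c i = z := by
  refine ⟨?_, fun h => ⟨c, fun _ => rfl, h⟩⟩
  rintro ⟨r, hr, h1, z, hz⟩
  choose m hm using fun i => coe_unitAddCircle_eq_iff.1 (hr i)
  have hc : ∀ i, c i = r i - m i := fun i => by linarith [hm i]
  refine ⟨fun j => ?_, z - ∑ i, m i, by simp [hc, hz]⟩
  obtain ⟨y, hy⟩ := h1 j
  choose p hp using fun i => hs i j
  exact ⟨y - ∑ i, m i * p i, by simp [hc, sub_mul, ← hy, hp]⟩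

lemma mem_simplexGroup_iff (hs : IsLatticeSimplex s) {l : Fin (d + 1) → UnitAddCircle} :
    l ∈ simplexGroup s ↔ (∀ j, ∃ z : ℤ, ∑ i, circleFract (l i) * s.points i j = z) ∧
      ∃ z : ℤ, ∑ i, circleFract (l i) = z := by
  simpa [coe_circleFract] using coe_mem_simplexGroup_iff hs fun i => circleFract (l i)

/-- The height `∑ {λᵢ}` of an element of `(ℝ/ℤ)^{d+1}`, rounded down; it is an integer on the
group of a lattice simplex. -/
noncomputable def height (l : Fin (d + 1) → UnitAddCircle) : ℕ := ⌊∑ i, circleFract (l i)⌋₊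

lemma height_eq (hs : IsLatticeSimplex s) {l : Fin (d + 1) → UnitAddCircle}
    (hl : l ∈ simplexGroup s) : (height l : ℝ) = ∑ i, circleFract (l i) := by
  obtain ⟨-, z, hz⟩ := (mem_simplexGroup_iff hs).1 hl
  have h0 : 0 ≤ ∑ i, circleFract (l i) := Finset.sum_nonneg fun i _ => circleFract_nonneg _
  rw [height, hz]
  rw [hz] at h0
  lift z to ℕ using (by exact_mod_cast h0)
  simp

/-- By affine independence an element is determined by the integers ∑ {λ_i}(v_i, 1), and these are
bounded because {λ_i} lies in [0, 1). -/
lemma finite_simplexGroup (hs : IsLatticeSimplex s) : Finite (simplexGroup s) := by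
  choose f hf using fun l : simplexGroup s => ((mem_simplexGroup_iff hs).1 l.2).1
  choose g hg using fun l : simplexGroup s => ((mem_simplexGroup_iff hs).1 l.2).2
  have hinj : Function.Injective fun l => (f l, g l) := by
    intro l l' h
    obtain ⟨h1, h2⟩ := Prod.mk.inj h
    have := s.coeff_injective (c := fun i => circleFract (l.1 i))
      (c' := fun i => circleFract (l'.1 i)) (by rw [hg, hg, h2]) (fun j => by rw [hf, hf, h1])
    exact Subtype.ext (funext fun i => circleFract_injective (congrFun this i))
  choose p hp using hs
  have hb : ∀ x : UnitAddCircle, |circleFract x| ≤ 1 := fun x => by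
    rw [abs_of_nonneg (circleFract_nonneg x)]; exact (circleFract_lt_one x).le
  have hf' : ∀ l j, |f l j| ≤ ∑ i, |p i j| := fun l j => by
    have : |(f l j : ℝ)| ≤ ∑ i, |(p i j : ℝ)| := by
      rw [← hf]
      refine (Finset.abs_sum_le_sum_abs _ _).trans (Finset.sum_le_sum fun i _ => ?_)
      rw [abs_mul, hp]
      exact mul_le_of_le_one_left (abs_nonneg _) (hb _)
    exact_mod_cast this
  have hg' : ∀ l, |g l| ≤ d + 1 := fun l => by
    have : |(g l : ℝ)| ≤ d + 1 := by
      rw [← hg]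
      refine (Finset.abs_sum_le_sum_abs _ _).trans
        ((Finset.sum_le_sum fun i _ => hb _).trans (by simp))
    exact_mod_cast this
  refine Set.finite_univ_iff.1 (Set.Finite.of_finite_image (f := fun l => (f l, g l)) ?_
    hinj.injOn)
  refine ((Set.finite_Icc (fun j => -∑ i, |p i j| : Fin d → ℤ) fun j => ∑ i, |p i j|).prod
    (Set.finite_Icc (-(d + 1 : ℤ)) (d + 1))).subset ?_
  rintro _ ⟨l, -, rfl⟩
  exact ⟨⟨fun j => (abs_le.1 (hf' l j)).1, fun j => (abs_le.1 (hf' l j)).2⟩,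
    abs_le.1 (hg' l)⟩

end

/-! ### The δ-polynomial as a height count on the group -/

section

variable {d : ℕ} {s : Affine.Simplex ℝ (Fin d → ℝ) d}

lemma mem_smul_simplexHull_iff (n : ℕ) (x : Fin d → ℝ) :
    x ∈ (n : ℝ) • simplexHull s ↔ ∃ c : Fin (d + 1) → ℝ, (∀ i, 0 ≤ c i) ∧ ∑ i, c i = n ∧
      ∀ j, ∑ i, c i * s.points i j = x j := by
  have key : ∀ y, y ∈ simplexHull s ↔ ∃ c : Fin (d + 1) → ℝ, (∀ i, 0 ≤ c i) ∧ ∑ i, c i = 1 ∧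
      ∀ j, ∑ i, c i * s.points i j = y j := by
    intro y
    rw [simplexHull, convexHull_range_eq_exists_affineCombination]
    constructor
    · rintro ⟨t, w, h0, h1, rfl⟩
      classical
      refine ⟨fun i => if i ∈ t then w i else 0, fun i => ?_, ?_, fun j => ?_⟩
      · dsimp only
        split_ifs with h
        exacts [h0 i h, le_rfl]
      · simpa using h1
      · rw [t.affineCombination_eq_linear_combination _ _ h1]
        simp [Finset.sum_apply, ite_mul]
    · rintro ⟨c, h0, h1, h⟩
      refine ⟨Finset.univ, c, fun i _ => h0 i, h1, ?_⟩
      rw [Finset.univ.affineCombination_eq_linear_combination _ _ h1]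
      ext j
      simp [← h]
  rw [Set.mem_smul_set]
  -- For n = 0 rescaling is impossible; the dilate is {0} because the hull is nonempty, and c = 0 is
  -- forced.
  rcases Nat.eq_zero_or_pos n with rfl | hn
  · constructor
    · rintro ⟨y, -, rfl⟩
      exact ⟨0, by simp, by simp, by simp⟩
    · rintro ⟨c, h0, h1, h⟩
      refine ⟨s.points 0, subset_convexHull ℝ _ ⟨0, rfl⟩, ?_⟩
      have hc : ∀ i, c i = 0 := fun i => by
        rw [Nat.cast_zero, Finset.sum_eq_zero_iff_of_nonneg fun i _ => h0 i] at h1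
        exact h1 i (Finset.mem_univ _)
      ext j
      simp [← h, hc]
  · have hn' : (n : ℝ) ≠ 0 := by positivity
    constructor
    · rintro ⟨y, hy, rfl⟩
      obtain ⟨c, h0, h1, h⟩ := (key y).1 hy
      refine ⟨fun i => n * c i, fun i => mul_nonneg n.cast_nonneg (h0 i), ?_, fun j => ?_⟩
      · rw [← Finset.mul_sum, h1, mul_one]
      · simp [mul_assoc, ← Finset.mul_sum, h]
    · rintro ⟨c, h0, h1, h⟩
      refine ⟨fun j => (n : ℝ)⁻¹ * x j, (key _).2 ⟨fun i => (n : ℝ)⁻¹ * c i,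
        fun i => mul_nonneg (by positivity) (h0 i), ?_, fun j => ?_⟩, ?_⟩
      · rw [← Finset.mul_sum, h1, inv_mul_cancel₀ hn']
      · simp [mul_assoc, ← Finset.mul_sum, h]
      · ext j
        simp [hn']

/-- The barycentric coordinates, scaled by `n`, of the lattice points in the `n`-th dilate. -/
def dilateCoeffs (s : Affine.Simplex ℝ (Fin d → ℝ) d) (n : ℕ) : Set (Fin (d + 1) → ℝ) :=
  {c | (∀ i, 0 ≤ c i) ∧ ∑ i, c i = n ∧ ∀ j, ∃ z : ℤ, ∑ i, c i * s.points i j = z}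

lemma latticePointCount_eq_ncard (n : ℕ) :
    latticePointCount (simplexHull s) n = (dilateCoeffs s n).ncard := by
  have h1 : Function.Injective fun (z : Fin d → ℤ) j => (z j : ℝ) := fun z z' h =>
    funext fun j => Int.cast_injective (congrFun h j)
  have h2 : Set.InjOn (fun (c : Fin (d + 1) → ℝ) j => ∑ i, c i * s.points i j)
      (dilateCoeffs s n) := fun c hc c' hc' h =>
    s.coeff_injective (hc.2.1.trans hc'.2.1.symm) fun j => congrFun h j
  rw [latticePointCount, ← Set.ncard_image_of_injective _ h1, ← h2.ncard_image]
  congr 1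
  ext x
  constructor
  · rintro ⟨z, hz, rfl⟩
    obtain ⟨c, h0, hn, h⟩ := (mem_smul_simplexHull_iff n _).1 hz
    exact ⟨c, ⟨h0, hn, fun j => ⟨z j, h j⟩⟩, funext h⟩
  · rintro ⟨c, ⟨h0, hn, h⟩, rfl⟩
    choose z hz using h
    exact ⟨z, (mem_smul_simplexHull_iff n _).2 ⟨c, h0, hn, hz⟩, funext fun j => (hz j).symm⟩

/-- A nonnegative coefficient vector splits into its fractional part, an element of the group of
the simplex, and its integral part. -/
lemma card_dilateCoeffs (hs : IsLatticeSimplex s) (n : ℕ) :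
    (dilateCoeffs s n).ncard = Nat.card
      (Σ l : simplexGroup s, {a : Fin (d + 1) → ℕ // ∑ i, a i + height l.1 = n}) := by
  symm
  choose p hp using id hs
  rw [← Nat.card_coe_set_eq]
  refine Nat.card_congr (Equiv.ofBijective
    (fun x => ⟨fun i => circleFract (x.1.1 i) + x.2.1 i, fun i => ?_, ?_, fun j => ?_⟩) ⟨?_, ?_⟩)
  · have := circleFract_nonneg (x.1.1 i)
    positivity
  · obtain ⟨l, a, ha⟩ := x
    simp only [Finset.sum_add_distrib, ← height_eq hs l.2, ← ha]
    push_cast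
    ring
  · obtain ⟨l, a, ha⟩ := x
    obtain ⟨z, hz⟩ := ((mem_simplexGroup_iff hs).1 l.2).1 j
    exact ⟨z + ∑ i, a i * p i j, by simp [add_mul, Finset.sum_add_distrib, ← hz, hp]⟩
  · rintro ⟨⟨l, hl⟩, a, ha⟩ ⟨⟨l', hl'⟩, a', ha'⟩ h
    have h' : ∀ i, circleFract (l i) + a i = circleFract (l' i) + a' i :=
      fun i => congrFun (congrArg Subtype.val h) i
    have h1 : l = l' := funext fun i => circleFract_injective <| by
      have := congrArg Int.fract (h' i)
      simpa [Int.fract_eq_self.2 ⟨circleFract_nonneg _, circleFract_lt_one _⟩] using this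
    subst h1
    have h2 : a = a' := funext fun i => by simpa using h' i
    subst h2
    rfl
  · rintro ⟨c, h0, hn, h⟩
    have hl : (fun i => (c i : UnitAddCircle)) ∈ simplexGroup s :=
      (coe_mem_simplexGroup_iff hs c).2 ⟨h, n, by simpa using hn⟩
    have hc : ∀ i, Int.fract (c i) + ⌊c i⌋₊ = c i := fun i => by
      rw [natCast_floor_eq_intCast_floor (h0 i), Int.fract_add_floor]
    refine ⟨⟨⟨_, hl⟩, fun i => ⌊c i⌋₊, ?_⟩, Subtype.ext (funext fun i => ?_)⟩
    · have := height_eq hs hl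
      rw [← Nat.cast_inj (R := ℝ), ← hn]
      push_cast
      rw [this, ← Finset.sum_add_distrib]
      refine Finset.sum_congr rfl fun i _ => ?_
      rw [circleFract_coe, add_comm, hc]
    · simp only [circleFract_coe, hc]

/-- Stars and bars: vectors in ℕ^{d+1} with sum n - m correspond to multisets of that size on d+1
letters; there are none if n < m. -/
lemma card_sum_add_eq (m n : ℕ) :
    (Nat.card {a : Fin (d + 1) → ℕ // ∑ i, a i + m = n} : ℤ) =
      PowerSeries.coeff n ((PowerSeries.X : PowerSeries ℤ) ^ m *
        PowerSeries.mk fun n => ((d + n).choose d : ℤ)) := by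
  rw [PowerSeries.coeff_X_pow_mul']
  split_ifs with h
  · obtain ⟨k, rfl⟩ := Nat.exists_eq_add_of_le' h
    simp only [add_left_inj, add_tsub_cancel_right, PowerSeries.coeff_mk]
    rw [← Nat.card_congr (Sym.equivNatSumOfFintype (Fin (d + 1)) k), Nat.card_eq_fintype_card,
      Sym.card_sym_eq_choose, Fintype.card_fin, Nat.choose_symm_of_eq_add (b := d) (by omega)]
    congr 2
    omega
  · have : IsEmpty {a : Fin (d + 1) → ℕ // ∑ i, a i + m = n} := ⟨fun a => h (by omega)⟩
    simp

/-- The `δ`-polynomial of a lattice simplex counts the elements of its group by height. -/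
theorem deltaSeries_simplexHull (hs : IsLatticeSimplex s) [Fintype (simplexGroup s)] :
    deltaSeries (simplexHull s) =
      ∑ l : simplexGroup s, (PowerSeries.X : PowerSeries ℤ) ^ height l.1 := by
  have hfin : ∀ m n : ℕ, Finite {a : Fin (d + 1) → ℕ // ∑ i, a i + m = n} := fun m n => by
    refine Finite.of_injective (β := Fin (d + 1) → Fin (n + 1))
      (fun a i => ⟨a.1 i, ?_⟩) fun a b h => Subtype.ext (funext fun i => ?_)
    · have := Finset.single_le_sum (f := a.1) (fun _ _ => Nat.zero_le _) (Finset.mem_univ i)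
      have := a.2
      omega
    · simpa using congrFun h i
  have hcount : ∀ n, (latticePointCount (simplexHull s) n : ℤ) = PowerSeries.coeff n
      ((∑ l : simplexGroup s, (PowerSeries.X : PowerSeries ℤ) ^ height l.1) *
        PowerSeries.mk fun n => ((d + n).choose d : ℤ)) := fun n => by
    rw [latticePointCount_eq_ncard, card_dilateCoeffs hs, Nat.card_sigma, Finset.sum_mul, map_sum]
    push_cast
    exact Finset.sum_congr rfl fun l _ => card_sum_add_eq _ _
  have hehr : ehrhartSeries (simplexHull s) =
      (∑ l : simplexGroup s, (PowerSeries.X : PowerSeries ℤ) ^ height l.1) *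
        PowerSeries.mk fun n => ((d + n).choose d : ℤ) := by
    ext n
    rw [← hcount, ehrhartSeries, PowerSeries.coeff_mk]
    -- The constant term 1, imposed by convention, agrees with the count at n = 0: the zero vector
    -- is the only nonnegative one with sum 0.
    split_ifs with h
    · subst h
      rw [latticePointCount_eq_ncard]
      have : dilateCoeffs s 0 = {0} := by
        ext c
        constructor
        · rintro ⟨h0, h1, -⟩
          rw [Nat.cast_zero, Finset.sum_eq_zero_iff_of_nonneg fun i _ => h0 i] at h1
          exact funext fun i => h1 i (Finset.mem_univ _)
        · rintro rfl
          exact ⟨by simp, by simp, fun j => ⟨0, by simp⟩⟩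
      simp [this]
    · rfl
  -- The series ∑ C(d+n, d) t^n is the inverse of (1-t)^{d+1}.
  rw [deltaSeries, hehr, mul_left_comm, mul_comm (_ ^ _),
    PowerSeries.mk_add_choose_mul_one_sub_pow_eq_one, mul_one]

end

/-! ### Dimension bounds from pairing λ with -λ -/

section

variable {d : ℕ} {s : Affine.Simplex ℝ (Fin d → ℝ) d}

/-- The elements of the group of a simplex whose `i`-th coordinate vanishes. -/
def coordKer (s : Affine.Simplex ℝ (Fin d → ℝ) d) (i : Fin (d + 1)) :
    AddSubgroup (simplexGroup s) :=
  ((Pi.evalAddMonoidHom (fun _ : Fin (d + 1) => UnitAddCircle) i).comp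
    (simplexGroup s).subtype).ker

lemma mem_coordKer {i : Fin (d + 1)} {l : simplexGroup s} : l ∈ coordKer s i ↔ l.1 i = 0 :=
  Iff.rfl

/-- Reindexing one copy of the sum by λ ↦ -λ, each coordinate contributes {λ_i} + {-λ_i}, which is 0
or 1 according to whether λ_i vanishes. Exchanging the sums counts, for each i, the elements outside
`coordKer s i`. -/
lemma two_mul_sum_height (hs : IsLatticeSimplex s) [Fintype (simplexGroup s)] :
    2 * ∑ l : simplexGroup s, (height l.1 : ℤ) =
      ∑ i, ((Nat.card (simplexGroup s) : ℤ) - Nat.card (coordKer s i)) := by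
  classical
  have h1 : ∑ l : simplexGroup s, (height l.1 : ℝ) =
      ∑ l : simplexGroup s, (height (-l).1 : ℝ) :=
    (Equiv.sum_comp (Equiv.neg (simplexGroup s)) fun l => (height l.1 : ℝ)).symm
  have h2 : 2 * ∑ l : simplexGroup s, (height l.1 : ℝ) =
      ∑ i, ((Nat.card (simplexGroup s) : ℝ) - Nat.card (coordKer s i)) := by
    rw [two_mul]
    nth_rewrite 2 [h1]
    rw [← Finset.sum_add_distrib]
    simp only [height_eq hs (Subtype.coe_prop _), ← Finset.sum_add_distrib]
    rw [Finset.sum_comm]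
    refine Finset.sum_congr rfl fun i _ => ?_
    have : ∀ l : simplexGroup s, circleFract (l.1 i) + circleFract ((-l).1 i) =
        1 - if l ∈ coordKer s i then 1 else 0 := fun l => by
      simp only [NegMemClass.coe_neg, Pi.neg_apply, circleFract_add_neg, mem_coordKer]
      split_ifs <;> simp
    simp only [this, Finset.sum_sub_distrib, Finset.sum_const, Finset.card_univ,
      Finset.sum_boole, nsmul_eq_mul, mul_one, Nat.card_eq_fintype_card]
    rw [Fintype.card_of_subtype (p := (· ∈ coordKer s i)) {l | l ∈ coordKer s i} (by simp)]
  exact_mod_cast h2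

/-- A proper subgroup has index at least 2. -/
lemma two_mul_card_coordKer_le (hs : IsLatticeSimplex s) {i : Fin (d + 1)}
    (hi : ∃ l ∈ simplexGroup s, l i ≠ 0) :
    2 * Nat.card (coordKer s i) ≤ Nat.card (simplexGroup s) := by
  have := finite_simplexGroup hs
  obtain ⟨m, hm⟩ := (coordKer s i).card_addSubgroup_dvd_card
  have h0 : 0 < Nat.card (simplexGroup s) := Nat.card_pos
  have hne : Nat.card (coordKer s i) ≠ Nat.card (simplexGroup s) := fun h => by
    obtain ⟨l, hl, hl0⟩ := hi
    have : (⟨l, hl⟩ : simplexGroup s) ∈ coordKer s i := by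
      rw [AddSubgroup.eq_top_of_card_eq _ h]; trivial
    exact hl0 (mem_coordKer.1 this)
  have hm2 : 2 ≤ m := by
    by_contra hlt
    interval_cases m <;> simp_all
  rw [hm, mul_comm]
  exact Nat.mul_le_mul_left _ hm2

lemma card_coordKer_pos (hs : IsLatticeSimplex s) (i : Fin (d + 1)) :
    1 ≤ Nat.card (coordKer s i) := by
  have := finite_simplexGroup hs
  exact Nat.card_pos

section

variable {ι : Type*} [Fintype ι] {f : ι → ℕ} {v k : ℕ}

lemma polynomial_sum_X_pow_eq
    (h : ∑ l, (PowerSeries.X : PowerSeries ℤ) ^ f l =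
      ∑ i ∈ Finset.range v, (PowerSeries.X : PowerSeries ℤ) ^ (i * (k + 1))) :
    ∑ l, (Polynomial.X : Polynomial ℤ) ^ f l =
      ∑ i ∈ Finset.range v, (Polynomial.X : Polynomial ℤ) ^ (i * (k + 1)) := by
  apply Polynomial.coe_injective ℤ
  rw [← Polynomial.coeToPowerSeries.ringHom_apply, ← Polynomial.coeToPowerSeries.ringHom_apply,
    map_sum, map_sum]
  simpa only [map_pow, Polynomial.coeToPowerSeries.ringHom_apply, Polynomial.coe_X] using h

lemma card_eq_of_sum_X_pow_eq
    (h : ∑ l, (PowerSeries.X : PowerSeries ℤ) ^ f l =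
      ∑ i ∈ Finset.range v, (PowerSeries.X : PowerSeries ℤ) ^ (i * (k + 1))) :
    Nat.card ι = v := by
  simpa [Polynomial.eval_finsetSum] using
    congrArg (Polynomial.eval 1) (polynomial_sum_X_pow_eq h)

lemma two_mul_sum_eq_of_sum_X_pow_eq
    (h : ∑ l, (PowerSeries.X : PowerSeries ℤ) ^ f l =
      ∑ i ∈ Finset.range v, (PowerSeries.X : PowerSeries ℤ) ^ (i * (k + 1))) :
    2 * ∑ l, (f l : ℤ) = v * (v - 1) * (k + 1) := by
  -- The derivative at 1 of a sum of powers of X is the sum of the exponents.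
  have h1 : ∑ l, (f l : ℤ) = ∑ i ∈ Finset.range v, ((i * (k + 1) : ℕ) : ℤ) := by
    simpa [Polynomial.derivative_sum, Polynomial.eval_finsetSum, Polynomial.derivative_X_pow]
      using congrArg (fun p => Polynomial.eval 1 (Polynomial.derivative p))
        (polynomial_sum_X_pow_eq h)
  rw [h1]
  clear h h1
  induction v with
  | zero => simp
  | succ n ih =>
    rw [Finset.sum_range_succ, mul_add, ih]
    push_cast
    ring

lemma exists_eq_of_sum_X_pow_eq
    (h : ∑ l, (PowerSeries.X : PowerSeries ℤ) ^ f l =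
      ∑ i ∈ Finset.range v, (PowerSeries.X : PowerSeries ℤ) ^ (i * (k + 1))) (hv : 2 ≤ v) :
    ∃ l, f l = k + 1 := by
  by_contra! hne
  have := congrArg (PowerSeries.coeff (k + 1)) h
  simp only [map_sum, PowerSeries.coeff_X_pow] at this
  rw [Finset.sum_eq_zero fun l _ => if_neg (hne l).symm] at this
  -- The term i = 1, present because v ≥ 2, contributes to the coefficient of X^{k+1}.
  have h1 : (1 : ℤ) ≤ ∑ i ∈ Finset.range v, if k + 1 = i * (k + 1) then 1 else 0 := by
    refine le_trans ?_ (Finset.single_le_sum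
      (f := fun i : ℕ => if k + 1 = i * (k + 1) then (1 : ℤ) else 0)
      (fun i _ => by positivity) (Finset.mem_range.2 hv : 1 ∈ Finset.range v))
    simp
  omega

end

variable {v k : ℕ}

/-- All elements of the group are constant vectors, so one vanishing coordinate forces all to
vanish. -/
lemma card_coordKer_of_eq_zmultiples
    (h : simplexGroup s = AddSubgroup.zmultiples
      (fun _ : Fin (d + 1) => ((1 / (v : ℝ) : ℝ) : UnitAddCircle))) (i : Fin (d + 1)) :
    Nat.card (coordKer s i) = 1 := by
  rw [AddSubgroup.card_eq_one, eq_bot_iff]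
  rintro ⟨l, hl⟩ h0
  rw [h] at hl
  obtain ⟨m, rfl⟩ := hl
  rw [mem_coordKer] at h0
  exact Subtype.ext (funext fun j => h0)

/-- If all coordinate projections of the group are injective and the group has order `v`, then an
element of height `(d + 1) / v` has all its coordinates equal to `1 / v`. -/
lemma simplexGroup_eq_zmultiples (hs : IsLatticeSimplex s) (hv : 2 ≤ v)
    (hcard : Nat.card (simplexGroup s) = v) (hker : ∀ i, Nat.card (coordKer s i) = 1)
    {l : Fin (d + 1) → UnitAddCircle} (hl : l ∈ simplexGroup s) (hl1 : 0 < height l)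
    (hl2 : v * height l = d + 1) :
    simplexGroup s = AddSubgroup.zmultiples
      (fun _ : Fin (d + 1) => ((1 / (v : ℝ) : ℝ) : UnitAddCircle)) := by
  have := finite_simplexGroup hs
  have hv0 : (0 : ℝ) < v := by positivity
  -- Each coordinate of l is nonzero, as the kernels are trivial, and is killed by v = |Λ|; its
  -- representative is thus a positive multiple of 1/v.
  have hge : ∀ i, 1 / (v : ℝ) ≤ circleFract (l i) := fun i => by
    have hli : l i ≠ 0 := fun h0 => by
      have hmem : (⟨l, hl⟩ : simplexGroup s) ∈ coordKer s i := h0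
      rw [AddSubgroup.card_eq_one.1 (hker i), AddSubgroup.mem_bot] at hmem
      have : l = 0 := congrArg Subtype.val hmem
      simp [this, height] at hl1
    have hvl : v • l i = 0 := by
      have h1 : Nat.card (simplexGroup s) • (⟨l, hl⟩ : simplexGroup s) = 0 := card_nsmul_eq_zero'
      rw [hcard] at h1
      exact congrFun (congrArg Subtype.val h1) i
    rw [← coe_circleFract (l i), ← AddCircle.coe_nsmul, AddCircle.coe_eq_zero_iff] at hvl
    obtain ⟨m, hm⟩ := hvl
    have hpos : 0 < circleFract (l i) :=
      (circleFract_nonneg _).lt_of_ne' (circleFract_eq_zero_iff.not.2 hli)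
    simp only [zsmul_eq_mul, mul_one, nsmul_eq_mul] at hm
    have hm0 : (0 : ℝ) < m := by rw [hm]; positivity
    have hm1 : (1 : ℝ) ≤ m := by exact_mod_cast (Int.cast_pos.1 hm0 : 0 < m)
    rw [div_le_iff₀ hv0]
    linarith
  -- The lower bounds 1/v already add up to the height of l, so all of them are equalities.
  have hsum : ∑ _i : Fin (d + 1), 1 / (v : ℝ) = ∑ i, circleFract (l i) := by
    rw [← height_eq hs hl]
    simp only [Finset.sum_const, Finset.card_univ, Fintype.card_fin, nsmul_eq_mul]
    rw [← hl2]
    push_cast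
    field_simp
  have heq : ∀ i, 1 / (v : ℝ) = circleFract (l i) := fun i =>
    (Finset.sum_eq_sum_iff_of_le fun i _ => hge i).1 hsum i (Finset.mem_univ i)
  have hl' : l = fun _ => ((1 / (v : ℝ) : ℝ) : UnitAddCircle) := funext fun i => by
    rw [heq i, coe_circleFract]
  have hord : v ∣ addOrderOf l := by
    have h1 : addOrderOf (l 0) = v := by
      rw [hl']
      exact AddCircle.addOrderOf_period_div (p := (1 : ℝ)) (by omega)
    rw [← h1]
    exact addOrderOf_map_dvd (Pi.evalAddMonoidHom (fun _ : Fin (d + 1) => UnitAddCircle) 0) l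
  have hle : AddSubgroup.zmultiples l ≤ simplexGroup s := by simpa using hl
  have hfin : Finite (AddSubgroup.zmultiples l) :=
    Set.Finite.subset (s := (simplexGroup s : Set _)) (Set.toFinite _) hle
  rw [← hl']
  refine (AddSubgroup.eq_of_le_of_card_ge hle ?_).symm
  rw [hcard, Nat.card_zmultiples]
  exact Nat.le_of_dvd (by rw [← Nat.card_zmultiples]; exact Nat.card_pos) hord

theorem dimension_bounds (hs : IsLatticeSimplex s)
    (hδ : deltaSeries (simplexHull s) =
        ∑ i ∈ Finset.range v, (PowerSeries.X : PowerSeries ℤ) ^ (i * (k + 1)))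
    (hne : ∀ i, ∃ l ∈ simplexGroup s, l i ≠ 0) :
    ((v : ℤ) * ((k : ℤ) + 1) - 1 ≤ (d : ℤ) ∧
        (d : ℤ) ≤ 4 * ((v : ℤ) - 1) * ((k : ℤ) + 1) - 2) ∧
      ((d : ℤ) = (v : ℤ) * ((k : ℤ) + 1) - 1 ↔
        simplexGroup s =
          AddSubgroup.zmultiples
            (fun _ : Fin (d + 1) => ((1 / (v : ℝ) : ℝ) : UnitAddCircle))) := by
  have := finite_simplexGroup hs
  have := Fintype.ofFinite (simplexGroup s)
  rw [deltaSeries_simplexHull hs] at hδ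
  have hcard := card_eq_of_sum_X_pow_eq hδ
  have hsum := two_mul_sum_height hs
  rw [two_mul_sum_eq_of_sum_X_pow_eq hδ, hcard] at hsum
  have hκ1 := card_coordKer_pos hs
  have hκ2 := fun i => two_mul_card_coordKer_le hs (hne i)
  rw [hcard] at hκ2
  -- The case v = 1 is excluded: a trivial group would have every coordinate vanishing.
  have hv : 2 ≤ v := by have := hκ1 0; have := hκ2 0; omega
  have hv' : (2 : ℤ) ≤ v := by exact_mod_cast hv
  have hup : ∑ i, ((v : ℤ) - Nat.card (coordKer s i)) ≤ (d + 1) * (v - 1) := by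
    refine (Finset.sum_le_card_nsmul _ _ ((v : ℤ) - 1) fun i _ => ?_).trans (by simp)
    have := hκ1 i
    omega
  have hlo : ((d : ℤ) + 1) * v ≤ 2 * ∑ i, ((v : ℤ) - Nat.card (coordKer s i)) := by
    rw [Finset.mul_sum]
    refine le_trans (by simp) (Finset.card_nsmul_le_sum _ _ (v : ℤ) fun i _ => ?_)
    have := hκ2 i
    omega
  -- Cancel v - 1 > 0 in `hup` for the lower bound and v > 0 in `hlo` for the upper one. With m =
  -- (v-1)(k+1) ≥ 1, the bound 2m - 1 on d is at most the required 4m - 2.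
  have h1 : (v : ℤ) * (k + 1) ≤ d + 1 := by nlinarith
  have h2 : (d : ℤ) + 1 ≤ 2 * ((v - 1) * (k + 1)) := by nlinarith
  have h3 : (1 : ℤ) ≤ (v - 1) * (k + 1) := by nlinarith
  refine ⟨⟨by linarith, by linarith⟩, fun hd => ?_, fun h => ?_⟩
  · have hd1 : (d : ℤ) + 1 = v * (k + 1) := by linarith
    have hker : ∀ i, Nat.card (coordKer s i) = 1 := by
      -- Equality in `hup` forces equality in each summand.
      have heq : ∑ i, ((v : ℤ) - Nat.card (coordKer s i)) = ∑ _i : Fin (d + 1), ((v : ℤ) - 1) := by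
        rw [← hsum]
        simp [hd1]
        ring
      intro i
      have := (Finset.sum_eq_sum_iff_of_le fun i _ => by have := hκ1 i; omega).1 heq i
        (Finset.mem_univ i)
      omega
    obtain ⟨l, hl⟩ := exists_eq_of_sum_X_pow_eq hδ hv
    exact simplexGroup_eq_zmultiples hs hv hcard hker l.2 (by omega)
      (by rw [hl]; exact_mod_cast hd1.symm)
  · simp only [card_coordKer_of_eq_zmultiples h, Finset.sum_const, Finset.card_univ,
      Fintype.card_fin, nsmul_eq_mul] at hsum
    push_cast at hsum
    have : ((v : ℤ) - 1) * (v * (k + 1)) = (v - 1) * (d + 1) := by linarith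
    have := mul_left_cancel₀ (by omega) this
    linarith

end

/-! ### A coordinate vanishing on the group gives a lattice pyramid -/

/-- A linear functional on `ℤ^{e+1}` that takes the value `1` at `u` is the last coordinate, and
`u` is the last unit vector, after a unimodular change of coordinates. -/
lemma exists_unimodular_last_coord {e : ℕ} (f : (Fin (e + 1) → ℤ) →ₗ[ℤ] ℤ) (u : Fin (e + 1) → ℤ)
    (hu : f u = 1) :
    ∃ U : Matrix (Fin (e + 1)) (Fin (e + 1)) ℤ, (U.det = 1 ∨ U.det = -1) ∧
      (∀ x, Matrix.vecMul x U (Fin.last e) = f x) ∧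
      Matrix.vecMul u U = Fin.snoc (α := fun _ => ℤ) 0 1 := by
  have hrank : Module.finrank ℤ (LinearMap.ker f) = e := by
    have h1 := Submodule.finrank_quotient_add_finrank (LinearMap.ker f)
    have h2 : Function.Surjective f := fun a => ⟨a • u, by rw [map_smul, hu, smul_eq_mul, mul_one]⟩
    rw [(f.quotKerEquivOfSurjective h2).finrank_eq, Module.finrank_self,
      Module.finrank_fin_fun] at h1
    omega
  let b : Module.Basis (Fin e) ℤ (LinearMap.ker f) := Module.finBasisOfFinrankEq ℤ _ hrank
  -- Since f u = 1, ℤ^{e+1} splits as ker f ⊕ ℤu, and q is the projection to ker f along u. The new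
  -- coordinates are those of q x in a basis of ker f, followed by f x.
  let q : (Fin (e + 1) → ℤ) →ₗ[ℤ] LinearMap.ker f :=
    (LinearMap.id - f.smulRight u).codRestrict _ fun x => by simp [hu, -zsmul_eq_mul]
  have hq : ∀ x, (q x : Fin (e + 1) → ℤ) = x - f x • u := fun _ => rfl
  let g : (Fin (e + 1) → ℤ) →ₗ[ℤ] Fin (e + 1) → ℤ :=
    { toFun := fun x => Fin.snoc (α := fun _ => ℤ) (b.equivFun (q x)) (f x)
      map_add' := fun x y => by
        ext i
        refine Fin.lastCases ?_ (fun i => ?_) i <;> simp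
      map_smul' := fun a x => by
        ext i
        refine Fin.lastCases ?_ (fun i => ?_) i <;> simp [-zsmul_eq_mul] }
  have hgu : g u = Fin.snoc (α := fun _ => ℤ) 0 1 := by
    have : q u = 0 := Subtype.ext (by simp [hq, hu])
    change Fin.snoc (α := fun _ => ℤ) (b.equivFun (q u)) (f u) = _
    rw [this, hu, map_zero]
  have hbij : Function.Bijective g := by
    constructor
    · refine (injective_iff_map_eq_zero g).2 fun x hx => ?_
      have h1 : f x = 0 := by simpa [g] using congrFun hx (Fin.last e)
      have h2 : b.equivFun (q x) = 0 := funext fun i => by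
        simpa [g] using congrFun hx (Fin.castSucc i)
      have h3 : q x = 0 := b.equivFun.map_eq_zero_iff.1 h2
      simpa [hq, h1] using congrArg Subtype.val h3
    · intro y
      let m := b.equivFun.symm (Fin.init y)
      have hm : f m = 0 := m.2
      refine ⟨m + y (Fin.last e) • u, ?_⟩
      have hqm : q (m + y (Fin.last e) • u) = m :=
        Subtype.ext (by rw [hq, map_add, map_smul, hu, hm]; simp)
      have hbm : b.equivFun m = Fin.init y := b.equivFun.apply_symm_apply _
      change Fin.snoc (α := fun _ => ℤ) (b.equivFun (q _)) (f _) = _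
      rw [hqm, hbm, map_add, hm, map_smul, hu, zero_add, smul_eq_mul, mul_one, Fin.snoc_init_self]
  let G := LinearEquiv.ofBijective g hbij
  have hU : ∀ x, Matrix.vecMul x (LinearMap.toMatrix' g).transpose = g x := fun x => by
    rw [Matrix.vecMul_transpose, LinearMap.toMatrix'_mulVec]
  refine ⟨(LinearMap.toMatrix' g).transpose, ?_, fun x => ?_, by rw [hU, hgu]⟩
  · rw [Matrix.det_transpose, LinearMap.det_toMatrix', ← Int.isUnit_iff]
    exact G.isUnit_det'
  · rw [hU]
    simp [g]

section

variable {d : ℕ} (s : Affine.Simplex ℝ (Fin d → ℝ) d)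

/-- The vertices of a full-dimensional simplex form an affine basis. -/
noncomputable def Affine.Simplex.affineBasis : AffineBasis (Fin (d + 1)) ℝ (Fin d → ℝ) :=
  ⟨s.points, s.independent,
    s.independent.affineSpan_eq_top_iff_card_eq_finrank_add_one.2 (by simp)⟩

variable {s}

/-- If the `i`-th coordinate vanishes on the group of a lattice simplex, then the `i`-th
barycentric coordinate is integral on lattice points. -/
lemma exists_int_coord (hs : IsLatticeSimplex s) {i : Fin (d + 1)}
    (hi : ∀ l ∈ simplexGroup s, l i = 0) (z : Fin d → ℤ) :
    ∃ a : ℤ, s.affineBasis.coord i (fun j => z j) = a := by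
  have h : (fun i => ((s.affineBasis.coord i fun j => (z j : ℝ) : ℝ) : UnitAddCircle)) ∈
      simplexGroup s := by
    refine (coe_mem_simplexGroup_iff hs _).2 ⟨fun j => ⟨z j, ?_⟩, 1, ?_⟩
    · have := congrFun (s.affineBasis.linear_combination_coord_eq_self fun j => (z j : ℝ)) j
      simp only [Finset.sum_apply, Pi.smul_apply, smul_eq_mul] at this
      exact this
    · simpa only [Int.cast_one] using s.affineBasis.sum_coord_apply_eq_one fun j => (z j : ℝ)
  obtain ⟨a, ha⟩ := AddCircle.coe_eq_zero_iff (1 : ℝ) |>.1 (hi _ h)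
  exact ⟨a, by simpa using ha.symm⟩

end

/-- The real affine map `x ↦ x U + w` of an integer matrix `U` and an integer vector `w`. -/
noncomputable def unimodularMap {d : ℕ} (U : Matrix (Fin d) (Fin d) ℤ) (w : Fin d → ℤ) :
    (Fin d → ℝ) →ᵃ[ℝ] (Fin d → ℝ) :=
  (Matrix.vecMulLinear (U.map fun a => (a : ℝ))).toAffineMap +
    AffineMap.const ℝ _ fun j => (w j : ℝ)

lemma unimodularMap_apply {d : ℕ} (U : Matrix (Fin d) (Fin d) ℤ) (w : Fin d → ℤ) (x : Fin d → ℝ) :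
    unimodularMap U w x = Matrix.vecMul x (U.map fun a => (a : ℝ)) + fun j => (w j : ℝ) := rfl

lemma unimodularMap_intCast {d : ℕ} (U : Matrix (Fin d) (Fin d) ℤ) (w z : Fin d → ℤ) :
    unimodularMap U w (fun j => (z j : ℝ)) = fun j => ((Matrix.vecMul z U + w) j : ℝ) := by
  ext j
  simp [unimodularMap_apply, Matrix.vecMul, dotProduct]

lemma unimodularMap_injective {d : ℕ} {U : Matrix (Fin d) (Fin d) ℤ} (w : Fin d → ℤ)
    (hU : U.det = 1 ∨ U.det = -1) : Function.Injective (unimodularMap U w) := by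
  have hdet : IsUnit (U.map fun a => (a : ℝ)) := by
    rw [Matrix.isUnit_iff_isUnit_det]
    have : (U.map fun a => (a : ℝ)).det = (U.det : ℝ) := ((Int.castRingHom ℝ).map_det U).symm
    rw [this]
    rcases hU with h | h <;> simp [h]
  intro x y h
  simp only [unimodularMap_apply, add_left_inj] at h
  exact Matrix.vecMul_injective_of_isUnit hdet h

/-- The inclusion of `ℝ^e` in `ℝ^{e+1}` as the hyperplane with last coordinate `0`. -/
noncomputable def snocZero (e : ℕ) : (Fin e → ℝ) →ₗ[ℝ] (Fin (e + 1) → ℝ) where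
  toFun x := Fin.snoc (α := fun _ => ℝ) x 0
  map_add' x y := by
    ext i
    refine Fin.lastCases ?_ (fun i => ?_) i <;> simp
  map_smul' a x := by
    ext i
    refine Fin.lastCases ?_ (fun i => ?_) i <;> simp

lemma latticePyramid_simplexHull {e : ℕ} (s : Affine.Simplex ℝ (Fin e → ℝ) e) :
    latticePyramid (simplexHull s) = convexHull ℝ
      (Set.range (fun i => Fin.snoc (α := fun _ => ℝ) (s.points i) 0) ∪
        {Fin.snoc (α := fun _ => ℝ) 0 1}) := by
  have h : (fun x => Fin.snoc (α := fun _ => ℝ) x 0) '' simplexHull s =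
      convexHull ℝ (Set.range fun i => Fin.snoc (α := fun _ => ℝ) (s.points i) 0) := by
    refine ((snocZero e).image_convexHull (Set.range s.points)).trans ?_
    rw [← Set.range_comp]
    rfl
  rw [latticePyramid, h, convexHull_convexHull_union_left]

/-- The i-th barycentric coordinate is integral on lattice points, is 1 at vertex i and 0 at the
others: vertex i has lattice height 1 over the opposite facet. Made into the last coordinate by a
unimodular map, it exhibits the pyramid. -/
theorem isLatticePyramid_of_coord_eq_zero {d : ℕ} (hd : 1 ≤ d)
    {s : Affine.Simplex ℝ (Fin d → ℝ) d} (hs : IsLatticeSimplex s) {i : Fin (d + 1)}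
    (hi : ∀ l ∈ simplexGroup s, l i = 0) : IsLatticePyramid (simplexHull s) := by
  obtain ⟨e, rfl⟩ := Nat.exists_eq_add_of_le' hd
  obtain ⟨j, hji⟩ := exists_ne i
  choose p hp using id hs
  have hp' : ∀ m, s.points m = fun n => (p m n : ℝ) := fun m => funext (hp m)
  have hcoord : ∀ m, s.affineBasis.coord i (s.points m) = if i = m then 1 else 0 := fun m =>
    s.affineBasis.coord_apply i m
  have hlin : ∀ z : Fin (e + 1) → ℤ, ∃ a : ℤ,
      (s.affineBasis.coord i).linear (fun n => (z n : ℝ)) = a := fun z => by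
    -- The coordinate vanishes at vertex j ≠ i, so its linear part at z is its value at the lattice
    -- point z + p j.
    obtain ⟨a, ha⟩ := exists_int_coord hs hi (z + p j)
    refine ⟨a, ?_⟩
    rw [← ha]
    have := (s.affineBasis.coord i).map_vadd (s.points j) fun n => (z n : ℝ)
    rw [hcoord, if_neg hji.symm, vadd_eq_add, vadd_eq_add, add_zero] at this
    rw [← this, hp']
    congr 1
    ext n
    simp
  choose F hF using hlin
  let f : (Fin (e + 1) → ℤ) →ₗ[ℤ] ℤ :=
    (AddMonoidHom.mk' F fun x y => by
      have h : (fun n => ((x + y) n : ℝ)) = (fun n => (x n : ℝ)) + fun n => (y n : ℝ) := by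
        ext n
        simp
      have := hF (x + y)
      rw [h, map_add, hF, hF] at this
      exact_mod_cast this.symm).toIntLinearMap
  have hf : ∀ m, f (p m - p j) = if i = m then 1 else 0 := fun m => by
    have h1 := hF (p m - p j)
    have h2 : (fun n => ((p m - p j) n : ℝ)) = s.points m -ᵥ s.points j := by
      ext n
      simp [hp]
    rw [h2, AffineMap.linearMap_vsub, hcoord, hcoord, if_neg hji.symm, vsub_eq_sub, sub_zero] at h1
    have h3 : ((if i = m then 1 else 0 : ℤ) : ℝ) = F (p m - p j) := by
      rw [← h1]
      split_ifs <;> simp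
    exact_mod_cast h3.symm
  obtain ⟨U, hU, hlast, hUu⟩ := exists_unimodular_last_coord f (p i - p j) (by simp [hf])
  -- This translation sends vertex j to the origin, placing the facet opposite to vertex i in the
  -- hyperplane where the last coordinate is 0.
  let w := -Matrix.vecMul (p j) U
  have hmap : ∀ m, unimodularMap U w (s.points m) =
      fun n => ((Matrix.vecMul (p m - p j) U n : ℤ) : ℝ) := fun m => by
    rw [hp', unimodularMap_intCast, Matrix.sub_vecMul, sub_eq_add_neg]
  have hmapi : unimodularMap U w (s.points i) = Fin.snoc (α := fun _ => ℝ) 0 1 := by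
    rw [hmap, hUu]
    ext n
    refine Fin.lastCases ?_ (fun n => ?_) n <;> simp
  let q : Fin (e + 1) → Fin e → ℝ := fun m n =>
    ((Matrix.vecMul (p (i.succAbove m) - p j) U (Fin.castSucc n) : ℤ) : ℝ)
  have hmapne : ∀ m, unimodularMap U w (s.points (i.succAbove m)) =
      Fin.snoc (α := fun _ => ℝ) (q m) 0 := fun m => by
    rw [hmap]
    ext n
    refine Fin.lastCases ?_ (fun n => ?_) n
    · simp [hlast, hf, (Fin.succAbove_ne i m).symm]
    · simp [q]
  have hq : AffineIndependent ℝ q := by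
    refine AffineIndependent.of_comp (snocZero e).toAffineMap ?_
    have heq : ⇑(snocZero e).toAffineMap ∘ q =
        (unimodularMap U w ∘ s.points) ∘ Fin.succAboveEmb i := funext fun m => (hmapne m).symm
    rw [heq]
    exact (s.independent.map' _ (unimodularMap_injective w hU)).comp_embedding (Fin.succAboveEmb i)
  refine ⟨⟨q, hq⟩, fun m n => ⟨_, rfl⟩, U, w, hU, ?_⟩
  rw [latticePyramid_simplexHull]
  refine Eq.trans ?_ ((unimodularMap U w).image_convexHull (Set.range s.points)).symm
  congr 1
  rw [← Set.range_comp]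
  ext x
  simp only [Set.mem_union, Set.mem_range, Set.mem_singleton_iff, Function.comp_apply]
  rw [Fin.exists_iff_succAbove (p := i), hmapi, or_comm, eq_comm]
  simp only [hmapne]

/-! ### A simplex with group generated by (1/v, …, 1/v) -/

section

variable {d v k : ℕ} {a : Fin d → ℤ}

/-- The vertices `e₁, …, e_d` together with the point whose coordinates are `v a_j - 1`. -/
def cyclicVertices (v : ℕ) (a : Fin d → ℤ) : Fin (d + 1) → Fin d → ℝ :=
  Fin.cons (fun j => v * a j - 1) fun i => Pi.single i 1

lemma sum_mul_cyclicVertices (c : Fin (d + 1) → ℝ) (j : Fin d) :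
    ∑ i, c i * cyclicVertices v a i j = c 0 * (v * a j - 1) + c j.succ := by
  simp [Fin.sum_univ_succ, cyclicVertices, Pi.single_apply]

/-- The coordinates of each e_i sum to 1, those of the extra vertex to vk - d = 1 - v. Hence v c_0
is determined by the coordinates and the coefficient sum, which gives affine independence and also
confines c_0 to (1/v)ℤ for group elements. -/
lemma sum_eq_of_sum_mul_cyclicVertices (hd : d + 1 = v * (k + 1)) (ha : ∑ j, a j = k)
    (c : Fin (d + 1) → ℝ) :
    ∑ i, c i = ∑ j, ∑ i, c i * cyclicVertices v a i j + v * c 0 := by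
  have ha' : ∑ j, (a j : ℝ) = k := by exact_mod_cast ha
  have hd' : (d : ℝ) + 1 = v * (k + 1) := by exact_mod_cast hd
  simp only [sum_mul_cyclicVertices]
  simp only [Fin.sum_univ_succ, Finset.sum_add_distrib, ← Finset.mul_sum,
    Finset.sum_sub_distrib, ha', Finset.sum_const, Finset.card_univ, Fintype.card_fin, nsmul_eq_mul]
  linear_combination c 0 * hd'

/-- The simplex with vertices `cyclicVertices v a`. -/
def cyclicSimplex (hv : 0 < v) (hd : d + 1 = v * (k + 1)) (ha : ∑ j, a j = k) :
    Affine.Simplex ℝ (Fin d → ℝ) d where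
  points := cyclicVertices v a
  independent := by
    rw [affineIndependent_iff_of_fintype]
    intro c hc hc'
    rw [Finset.univ.weightedVSub_eq_linear_combination hc] at hc'
    have h : ∀ j, ∑ i, c i * cyclicVertices v a i j = 0 := fun j => by
      simpa using congrFun hc' j
    have h0 : c 0 = 0 := by
      have := sum_eq_of_sum_mul_cyclicVertices hd ha c
      simpa [hc, h, hv.ne'] using this
    refine Fin.cases h0 fun j => ?_
    simpa [sum_mul_cyclicVertices, h0] using h j

lemma isLatticeSimplex_cyclicSimplex (hv : 0 < v) (hd : d + 1 = v * (k + 1)) (ha : ∑ j, a j = k) :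
    IsLatticeSimplex (cyclicSimplex hv hd ha) := by
  refine Fin.cases (fun j => ⟨v * a j - 1, ?_⟩) fun i j => ⟨Pi.single (M := fun _ => ℤ) i 1 j, ?_⟩
  · simp [cyclicSimplex, cyclicVertices]
  · simp only [cyclicSimplex, cyclicVertices, Fin.cons_succ, Pi.single_apply]
    split_ifs <;> simp

lemma mem_simplexGroup_cyclicSimplex (hv : 0 < v) (hd : d + 1 = v * (k + 1)) (ha : ∑ j, a j = k)
    {l : Fin (d + 1) → UnitAddCircle} :
    l ∈ simplexGroup (cyclicSimplex hv hd ha) ↔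
      ∃ n < v, l = fun _ => (((n : ℝ) / v : ℝ) : UnitAddCircle) := by
  have hs := isLatticeSimplex_cyclicSimplex hv hd ha
  have hv' : (v : ℝ) ≠ 0 := by positivity
  constructor
  · intro hl
    obtain ⟨h1, z, hz⟩ := (mem_simplexGroup_iff hs).1 hl
    choose y hy using h1
    change ∀ j, ∑ i, circleFract (l i) * cyclicVertices v a i j = _ at hy
    have hm := sum_eq_of_sum_mul_cyclicVertices hd ha fun i => circleFract (l i)
    simp only [hy, hz] at hm
    have hm' : v * circleFract (l 0) = ((z - ∑ j, y j : ℤ) : ℝ) := by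
      push_cast
      linarith
    have h0 : 0 ≤ z - ∑ j, y j := by
      have := circleFract_nonneg (l 0)
      have : (0 : ℝ) ≤ ((z - ∑ j, y j : ℤ) : ℝ) := by rw [← hm']; positivity
      exact_mod_cast this
    obtain ⟨n, hn⟩ := Int.eq_ofNat_of_zero_le h0
    rw [hn, Int.cast_natCast] at hm'
    have hn0 : circleFract (l 0) = n / v := by rw [← hm']; field_simp
    refine ⟨n, ?_, funext fun i => ?_⟩
    · have := circleFract_lt_one (l 0)
      rw [hn0, div_lt_one (by positivity)] at this
      exact_mod_cast this
    · rw [← hn0, ← coe_circleFract (l i), coe_unitAddCircle_eq_iff]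
      revert i
      -- Coordinate j reads c_0 (v a_j - 1) + c_{j+1} = y_j; with v c_0 = n, the difference c_{j+1}
      -- - c_0 is y_j - n a_j.
      refine Fin.cases ⟨0, by simp⟩ fun j => ⟨y j - n * a j, ?_⟩
      have := hy j
      rw [sum_mul_cyclicVertices] at this
      push_cast
      rw [← this, ← hm']
      ring
  · rintro ⟨n, -, rfl⟩
    refine (coe_mem_simplexGroup_iff hs fun _ => (n : ℝ) / v).2 ⟨fun j => ⟨n * a j, ?_⟩,
      n * (k + 1), ?_⟩
    · refine (sum_mul_cyclicVertices _ j).trans ?_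
      push_cast
      field_simp
      ring
    · have hd' : (d : ℝ) + 1 = v * (k + 1) := by exact_mod_cast hd
      simp only [Finset.sum_const, Finset.card_univ, Fintype.card_fin, nsmul_eq_mul]
      push_cast
      rw [hd']
      field_simp

lemma circleFract_natCast_div {n : ℕ} (hn : n < v) :
    circleFract (((n : ℝ) / v : ℝ) : UnitAddCircle) = n / v := by
  have hv : (0 : ℝ) < v := by exact_mod_cast n.zero_le.trans_lt hn
  rw [circleFract_coe, Int.fract_eq_self]
  exact ⟨by positivity, (div_lt_one hv).2 (by exact_mod_cast hn)⟩

lemma height_const_natCast_div (hd : d + 1 = v * (k + 1)) {n : ℕ} (hn : n < v) :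
    height (fun _ : Fin (d + 1) => (((n : ℝ) / v : ℝ) : UnitAddCircle)) = n * (k + 1) := by
  have hv : (0 : ℝ) < v := by exact_mod_cast n.zero_le.trans_lt hn
  have hd' : (d : ℝ) + 1 = v * (k + 1) := by exact_mod_cast hd
  have h : ((d + 1 : ℕ) : ℝ) * (n / v) = ((n * (k + 1) : ℕ) : ℝ) := by
    push_cast
    rw [hd']
    field_simp
  simp only [height, circleFract_natCast_div hn, Finset.sum_const, Finset.card_univ,
    Fintype.card_fin, nsmul_eq_mul]
  rw [h, Nat.floor_natCast]

lemma deltaSeries_cyclicSimplex (hv : 0 < v) (hd : d + 1 = v * (k + 1)) (ha : ∑ j, a j = k) :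
    deltaSeries (simplexHull (cyclicSimplex hv hd ha)) =
      ∑ i ∈ Finset.range v, (PowerSeries.X : PowerSeries ℤ) ^ (i * (k + 1)) := by
  have hs := isLatticeSimplex_cyclicSimplex hv hd ha
  have := finite_simplexGroup hs
  have := Fintype.ofFinite (simplexGroup (cyclicSimplex hv hd ha))
  rw [deltaSeries_simplexHull hs]
  symm
  refine Finset.sum_bij (fun n hn => ⟨_, (mem_simplexGroup_cyclicSimplex hv hd ha).2
    ⟨n, Finset.mem_range.1 hn, rfl⟩⟩) (fun _ _ => Finset.mem_univ _) ?_ ?_ ?_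
  · intro m hm n hn h
    have h0 := congrArg circleFract (congrFun (congrArg Subtype.val h) 0)
    rw [circleFract_natCast_div (Finset.mem_range.1 hm),
      circleFract_natCast_div (Finset.mem_range.1 hn)] at h0
    have hv' : (v : ℝ) ≠ 0 := by positivity
    field_simp at h0
    exact_mod_cast h0
  · rintro ⟨l, hl⟩ -
    obtain ⟨n, hn, rfl⟩ := (mem_simplexGroup_cyclicSimplex hv hd ha).1 hl
    exact ⟨n, Finset.mem_range.2 hn, rfl⟩
  · intro n hn
    rw [height_const_natCast_div hd (Finset.mem_range.1 hn)]

end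

theorem exists_latticeSimplex_deltaSeries_eq (v k : ℕ) (hv : 0 < v) :
    ∃ (d : ℕ) (s : Affine.Simplex ℝ (Fin d → ℝ) d), IsLatticeSimplex s ∧
      deltaSeries (simplexHull s) =
        ∑ i ∈ Finset.range v, (PowerSeries.X : PowerSeries ℤ) ^ (i * (k + 1)) := by
  obtain ⟨d, hd⟩ : ∃ d, d + 1 = v * (k + 1) := Nat.exists_add_one_eq.2 (by positivity)
  obtain ⟨a, ha⟩ : ∃ a : Fin d → ℤ, ∑ j, a j = k := by
    -- In dimension 0 the sum of the a_j is empty, but v(k+1) = 1 forces k = 0.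
    rcases d with _ | e
    · have hk : k = 0 := by
        have := Nat.eq_one_of_mul_eq_one_left (by omega : v * (k + 1) = 1)
        omega
      exact ⟨0, by simp [hk]⟩
    · exact ⟨Pi.single 0 k, by simp⟩
  exact ⟨d, cyclicSimplex hv hd ha, isLatticeSimplex_cyclicSimplex hv hd ha,
    deltaSeries_cyclicSimplex hv hd ha⟩

/-! ### Existence and bounds combined -/

theorem theorem2p1 (v k : ℕ) (hv : 0 < v) :
    (∃ (d : ℕ) (s : Affine.Simplex ℝ (Fin d → ℝ) d), IsLatticeSimplex s ∧
      deltaSeries (simplexHull s) =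
        ∑ i ∈ Finset.range v, (PowerSeries.X : PowerSeries ℤ) ^ (i * (k + 1))) ∧
    ∀ (d : ℕ) (s : Affine.Simplex ℝ (Fin d → ℝ) d), 1 ≤ d → IsLatticeSimplex s →
      deltaSeries (simplexHull s) =
        ∑ i ∈ Finset.range v, (PowerSeries.X : PowerSeries ℤ) ^ (i * (k + 1)) →
      ¬ IsLatticePyramid (simplexHull s) →
      ((v : ℤ) * ((k : ℤ) + 1) - 1 ≤ (d : ℤ) ∧
        (d : ℤ) ≤ 4 * ((v : ℤ) - 1) * ((k : ℤ) + 1) - 2) ∧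
      ((d : ℤ) = (v : ℤ) * ((k : ℤ) + 1) - 1 ↔
        simplexGroup s =
          AddSubgroup.zmultiples
            (fun _ : Fin (d + 1) => ((1 / (v : ℝ) : ℝ) : UnitAddCircle))) := by
  refine ⟨exists_latticeSimplex_deltaSeries_eq v k hv, fun d s hd hs hδ hpyr => ?_⟩
  refine dimension_bounds hs hδ fun i => ?_
  by_contra! h
  exact hpyr (isLatticePyramid_of_coord_eq_zero hd hs h)
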